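/- Let $L$ and $s$ be positive integers, let $V \subseteq \{s+1,\dots,L+s\}$, and put $t=|V|$. Let $I_{L,s,V}$ be the set of integer partitions whose smallest part is $s$, all of whose parts are $\le L+s$, and in which no element of $V$ occurs as a part. Let $D_{L,s,V}$ be the set of nonempty integer partitions all of whose parts lie in $\{s+1,\dots,L+s\}$ and in which each member of $V$ occurs a perfect $t$-th power number of times (that is, $m^t$ times for some integer $m\ge 0$). Suppose that $t\le \frac{L-2}{2}$. Then for every integer $N \ge (10s)^5(t+1)^4(39s^2t^3)^{5t}$, $$|\{\pi\in I_{L,s,V} : |\pi|=N\}| \ \ge\ |\{\pi\in D_{L,s,V} : |\pi|=N\}|,$$ where $|\pi|$ is the sum of the parts of $\pi$. (If $V=\emptyset$, the condition on frequencies is void and the factor $(39s^2t^3)^{5t}$ is read as $1$.) -/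

import Mathlib

/-- The partitions of `N` lying in `I_{L,s,V}`: the smallest part is `s`, all parts are at most
`L + s`, and no element of `V` occurs as a part. -/
def partitionsI (L s : ℕ) (V : Finset ℕ) (N : ℕ) : Set (Nat.Partition N) :=
  {π | IsLeast {p | p ∈ π.parts} s ∧ (∀ p ∈ π.parts, p ≤ L + s) ∧ ∀ k ∈ V, k ∉ π.parts}

/-- The partitions of `N` lying in `D_{L,s,V}`: nonempty partitions with all parts in
`{s+1, …, L+s}` in which the number of occurrences of each member of `V` is a perfect `t`-th power
`m ^ t` with `m ≥ 0`, where `t = |V|`. -/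
def partitionsD (L s : ℕ) (V : Finset ℕ) (N : ℕ) : Set (Nat.Partition N) :=
  {π | π.parts ≠ 0 ∧ (∀ p ∈ π.parts, p ∈ Finset.Icc (s + 1) (L + s)) ∧
    ∀ k ∈ V, ∃ m : ℕ, π.parts.count k = m ^ V.card}

/-! Split a partition counted on the right into ν, its parts in V, and λ, its parts in the set W of
allowed parts outside V. As t ≤ (L - 2)/2, W contains two consecutive numbers x, x + 1, and every r
≥ x² is a sum of copies of them. So ν, possibly with some of λ, can be traded for copies of s plus
such a sum, the multiplicity of s recording how to undo the trade. Three kinds of pairs are sent to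
disjoint classes of this multiplicity, for a suitable modulus M.

The exponent t = |V| matters here: at most (k + 1)^t multisets ν have all roots ≤ k, while a root k
forces |ν| ≥ (s + 1)k^t. Hence a ν with a large root can pay for its own code number in copies of s
(`ncard_big_le`, multiplicity not divisible by M). The remaining ν have codes below a constant S. If
some part of λ occurs J times, J copies of it pay for a code of both ν and that part
(`ncard_frequent_le`, 0 mod 2M). Otherwise a large N gives λ many exchanges of a single part, and
double counting suffices (`ncard_infrequent_le`, M mod 2M). -/

/-- `r` written as a sum of copies of `x` and `x + 1`, using fewer than `x` copies of `x + 1`. -/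
def pairRep (x r : ℕ) : Multiset ℕ :=
  Multiset.replicate (r / x - r % x) x + Multiset.replicate (r % x) (x + 1)

/-- Writing r = qx + ρ with ρ ≤ q, raise ρ of the q copies of x by one. -/
lemma sum_pairRep {x r : ℕ} (h : r % x ≤ r / x) : (pairRep x r).sum = r := by
  obtain ⟨d, hd⟩ := Nat.exists_eq_add_of_le h
  have h1 := Nat.div_add_mod r x
  simp only [pairRep, Multiset.sum_add, Multiset.sum_replicate, smul_eq_mul]
  rw [hd] at h1 ⊢
  rw [Nat.add_sub_cancel_left]
  linarith

lemma mod_le_div_of_sq_le {x r : ℕ} (hx : 0 < x) (h : x ^ 2 ≤ r) : r % x ≤ r / x :=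
  (Nat.mod_lt r hx).le.trans ((Nat.le_div_iff_mul_le hx).2 (by rwa [← sq]))

lemma mem_pairRep {x r p : ℕ} (h : p ∈ pairRep x r) : p = x ∨ p = x + 1 := by
  rcases Multiset.mem_add.1 h with h | h
  · exact Or.inl (Multiset.eq_of_mem_replicate h)
  · exact Or.inr (Multiset.eq_of_mem_replicate h)

lemma count_pairRep_of_lt {x r s : ℕ} (h : s < x) : (pairRep x r).count s = 0 :=
  Multiset.count_eq_zero.2 fun hm => by rcases mem_pairRep hm with h' | h' <;> omega

lemma count_pairRep_self (x r : ℕ) : (pairRep x r).count x = r / x - r % x := by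
  simp [pairRep, Multiset.count_replicate]

/-- Multisets of positive integers with bounded sum form a finite set. -/
lemma finite_multisets_sum_le (N : ℕ) : {μ : Multiset ℕ | 0 ∉ μ ∧ μ.sum ≤ N}.Finite := by
  have : {μ : Multiset ℕ | 0 ∉ μ ∧ μ.sum ≤ N} ⊆
      ⋃ n ∈ Finset.range (N + 1), Set.range (fun π : Nat.Partition n => π.parts) := by
    rintro μ ⟨h0, hN⟩
    simp only [Set.mem_iUnion, Finset.mem_range]
    exact ⟨μ.sum, by omega, ⟨μ, fun {i} hi => Nat.pos_of_ne_zero fun h => h0 (h ▸ hi), rfl⟩, rfl⟩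
  exact (Set.Finite.biUnion (Finset.finite_toSet _) fun _ _ => Set.finite_range _).subset this

/-- A value p ≥ 2c is at most 2(p - c), and the values below 2c contribute at most (2c)². -/
lemma sum_le_of_count_le {lam : Multiset ℕ} {J : ℕ} (hJ : ∀ p, lam.count p ≤ J) (c : ℕ) :
    lam.sum ≤ J * (2 * ∑ p ∈ lam.toFinset, (p - c) + 4 * c ^ 2) := by
  have h1 : lam.sum ≤ J * ∑ p ∈ lam.toFinset, p := by
    rw [Finset.sum_multiset_count, Finset.mul_sum]
    exact Finset.sum_le_sum fun p _ => Nat.mul_le_mul_right _ (hJ p)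
  refine h1.trans (Nat.mul_le_mul_left _ ?_)
  have h2 : ∑ p ∈ lam.toFinset, p ≤
      ∑ p ∈ lam.toFinset, (2 * (p - c) + if p < 2 * c then 2 * c else 0) :=
    Finset.sum_le_sum fun p _ => by split_ifs <;> omega
  refine h2.trans ?_
  rw [Finset.sum_add_distrib, ← Finset.mul_sum, ← Finset.sum_filter, Finset.sum_const, smul_eq_mul]
  have h3 : (lam.toFinset.filter (· < 2 * c)).card ≤ 2 * c := by
    simpa using Finset.card_le_card (t := Finset.range (2 * c))
      (s := lam.toFinset.filter (· < 2 * c)) (fun p hp => by simpa using (Finset.mem_filter.1 hp).2)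
  nlinarith [Nat.mul_le_mul_right (2 * c) h3]

/-! ### Three encodings by the multiplicity of `s` -/

section SplitPairs

variable {s x M S J K N : ℕ} {W : Set ℕ} {T : Set (Multiset ℕ)} {f F : Multiset ℕ → ℕ}

/-- Pairs of a multiset from `T` and a multiset of elements of `W`, of total sum `N`. -/
def splitPairs (N : ℕ) (W : Set ℕ) (T : Set (Multiset ℕ)) : Set (Multiset ℕ × Multiset ℕ) :=
  {z | z.1 ∈ T ∧ (∀ p ∈ z.2, p ∈ W) ∧ z.1.sum + z.2.sum = N}

/-- Multisets of sum `N` with entries `s`, occurring at least once, and elements of `W`. -/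
def withLeast (N s : ℕ) (W : Set ℕ) : Set (Multiset ℕ) :=
  {μ | s ∈ μ ∧ (∀ p ∈ μ, p = s ∨ p ∈ W) ∧ μ.sum = N}

lemma finite_withLeast (hs : 0 < s) (hW : ∀ p ∈ W, s < p) : (withLeast N s W).Finite :=
  (finite_multisets_sum_le N).subset fun μ hμ =>
    ⟨fun h0 => by
      rcases hμ.2.1 0 h0 with h | h
      · omega
      · exact absurd (hW 0 h) (by omega), hμ.2.2.le⟩

lemma finite_splitPairs (hW : ∀ p ∈ W, s < p) (hT : ∀ ν ∈ T, 0 ∉ ν) :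
    (splitPairs N W T).Finite :=
  ((finite_multisets_sum_le N).prod (finite_multisets_sum_le N)).subset fun z hz =>
    ⟨⟨hT _ hz.1, by have := hz.2.2; omega⟩,
      ⟨fun h0 => absurd (hW 0 (hz.2.1 0 h0)) (by omega), by have := hz.2.2; omega⟩⟩

/-- Adding copies of `s` and a representation of `r` to a multiset of elements of `W`. -/
lemma add_mem_withLeast {lam : Multiset ℕ} {g r : ℕ} (hx : x ∈ W) (hx' : x + 1 ∈ W)
    (hlam : ∀ p ∈ lam, p ∈ W) (hg : 0 < g) (hr : r % x ≤ r / x)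
    (hsum : lam.sum + s * g + r = N) :
    lam + Multiset.replicate g s + pairRep x r ∈ withLeast N s W := by
  refine ⟨?_, ?_, ?_⟩
  · simp [Multiset.mem_replicate, hg.ne']
  · intro p hp
    rcases Multiset.mem_add.1 hp with hp | hp
    · rcases Multiset.mem_add.1 hp with hp | hp
      · exact Or.inr (hlam p hp)
      · exact Or.inl (Multiset.eq_of_mem_replicate hp)
    · rcases mem_pairRep hp with rfl | rfl
      · exact Or.inr hx
      · exact Or.inr hx'
  · simp only [Multiset.sum_add, Multiset.sum_replicate, sum_pairRep hr, smul_eq_mul]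
    linarith

lemma count_add_replicate_add {lam : Multiset ℕ} {g r : ℕ} (hW : ∀ p ∈ W, s < p) (hx : x ∈ W)
    (hlam : ∀ p ∈ lam, p ∈ W) :
    (lam + Multiset.replicate g s + pairRep x r).count s = g := by
  have : lam.count s = 0 := Multiset.count_eq_zero.2 fun h => lt_irrefl _ (hW s (hlam s h))
  simp [this, count_pairRep_of_lt (hW x hx)]

/-- The multiplicity of `s` in the image is F(ν), which determines ν; then λ follows by
cancellation. -/
lemma ncard_big_le (hs : 0 < s) (hW : ∀ p ∈ W, s < p) (hx : x ∈ W) (hx' : x + 1 ∈ W)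
    (hF : ∀ ν ∈ T, s * F ν + x ^ 2 ≤ ν.sum → F ν % M ≠ 0)
    (hFinj : Set.InjOn F (T ∩ {ν | s * F ν + x ^ 2 ≤ ν.sum})) :
    (splitPairs N W T ∩ {z | s * F z.1 + x ^ 2 ≤ z.1.sum}).ncard ≤
      (withLeast N s W ∩ {μ | μ.count s % M ≠ 0}).ncard := by
  refine Set.ncard_le_ncard_of_injOn
    (fun z => z.2 + Multiset.replicate (F z.1) s + pairRep x (z.1.sum - s * F z.1)) ?_ ?_
    ((finite_withLeast hs hW).inter_of_left _)
  · rintro ⟨ν, lam⟩ ⟨⟨hν, hlam, hN⟩, hb⟩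
    simp only [Set.mem_ofPred_eq] at hν hlam hN hb ⊢
    have h0 := hF ν hν hb
    refine ⟨add_mem_withLeast hx hx' hlam ?_ ?_ ?_, ?_⟩
    · exact Nat.pos_of_ne_zero fun h => h0 (by simp [h])
    · exact mod_le_div_of_sq_le (by have := hW x hx; omega) (by omega)
    · omega
    · simpa only [Set.mem_ofPred_eq, count_add_replicate_add hW hx hlam] using h0
  · rintro ⟨ν, lam⟩ ⟨⟨hν, hlam, hN⟩, hb⟩ ⟨ν', lam'⟩ ⟨⟨hν', hlam', hN'⟩, hb'⟩ h
    simp only [Set.mem_ofPred_eq] at hν hlam hb hν' hlam' hb' h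
    have hc := congrArg (Multiset.count s) h
    rw [count_add_replicate_add hW hx hlam, count_add_replicate_add hW hx hlam'] at hc
    obtain rfl := hFinj ⟨hν, hb⟩ ⟨hν', hb'⟩ hc
    simpa using h

/-- The multiplicity of `s`, divided by 2M, is Sp + f(ν) with f(ν) < S, so it determines both ν and
the repeated part p. -/
lemma ncard_frequent_le (hs : 0 < s) (hW : ∀ p ∈ W, s < p) (hx : x ∈ W) (hx' : x + 1 ∈ W)
    (hM : 0 < M) {B : Set (Multiset ℕ)}
    (hf : ∀ ν ∈ T ∩ B, f ν < S) (hfinj : Set.InjOn f (T ∩ B))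
    (hJ : ∀ ν ∈ T ∩ B, ∀ p ∈ W, s * (2 * M * (S * p + f ν)) ≤ J * p + ν.sum ∧
      (J * p + ν.sum - s * (2 * M * (S * p + f ν))) % x ≤
        (J * p + ν.sum - s * (2 * M * (S * p + f ν))) / x)
    (hJ0 : 0 < J) :
    (splitPairs N W T ∩ {z | z.1 ∈ B ∧ ∃ p, J ≤ z.2.count p}).ncard ≤
      (withLeast N s W ∩ {μ | μ.count s % (2 * M) = 0}).ncard := by
  classical
  -- The value 0 is a dummy when no part is frequent.
  have hex : ∀ lam : Multiset ℕ, ∃ p, (∃ p, J ≤ lam.count p) → J ≤ lam.count p := fun lam => by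
    by_cases h : ∃ p, J ≤ lam.count p
    · exact ⟨h.choose, fun _ => h.choose_spec⟩
    · exact ⟨0, fun h' => absurd h' h⟩
  choose q hq using hex
  have key : ∀ z ∈ splitPairs N W T ∩ {z | z.1 ∈ B ∧ ∃ p, J ≤ z.2.count p},
      q z.2 ∈ W ∧ Multiset.replicate J (q z.2) ≤ z.2 := fun z hz => by
    have h := hq z.2 hz.2.2
    exact ⟨hz.1.2.1 _ (Multiset.count_pos.1 (by omega)), Multiset.le_count_iff_replicate_le.1 h⟩
  refine Set.ncard_le_ncard_of_injOn
    (fun z => (z.2 - Multiset.replicate J (q z.2)) +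
      Multiset.replicate (2 * M * (S * q z.2 + f z.1)) s +
      pairRep x (J * q z.2 + z.1.sum - s * (2 * M * (S * q z.2 + f z.1)))) ?_ ?_
    ((finite_withLeast hs hW).inter_of_left _)
  · rintro ⟨ν, lam⟩ hz
    obtain ⟨hqW, hqr⟩ := key _ hz
    obtain ⟨⟨hν, hlam, hN⟩, hb, -⟩ := hz
    simp only at hν hlam hN hb hqW hqr ⊢
    obtain ⟨h1, h2⟩ := hJ ν ⟨hν, hb⟩ _ hqW
    have hsub : ∀ p ∈ lam - Multiset.replicate J (q lam), p ∈ W := fun p hp =>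
      hlam p (Multiset.mem_of_le (Multiset.sub_le_self _ _) hp)
    have hS : 0 < S := (Nat.zero_le _).trans_lt (hf ν ⟨hν, hb⟩)
    have hq0 : 0 < q lam := (Nat.zero_le _).trans_lt (hW _ hqW)
    refine ⟨add_mem_withLeast hx hx' hsub (by positivity) h2 ?_, ?_⟩
    · have := congrArg Multiset.sum (Multiset.sub_add_cancel hqr)
      simp only [Multiset.sum_add, Multiset.sum_replicate, smul_eq_mul] at this
      omega
    · simp only [Set.mem_ofPred_eq, count_add_replicate_add hW hx hsub, Nat.mul_mod_right]
  · rintro ⟨ν, lam⟩ hz ⟨ν', lam'⟩ hz' h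
    obtain ⟨hqW, hqr⟩ := key _ hz
    obtain ⟨hqW', hqr'⟩ := key _ hz'
    obtain ⟨⟨hν, hlam, hN⟩, hb, -⟩ := hz
    obtain ⟨⟨hν', hlam', hN'⟩, hb', -⟩ := hz'
    simp only at hν hlam hb hν' hlam' hb' h hqr hqr'
    have hsub : ∀ p ∈ lam - Multiset.replicate J (q lam), p ∈ W := fun p hp =>
      hlam p (Multiset.mem_of_le (Multiset.sub_le_self _ _) hp)
    have hsub' : ∀ p ∈ lam' - Multiset.replicate J (q lam'), p ∈ W := fun p hp =>
      hlam' p (Multiset.mem_of_le (Multiset.sub_le_self _ _) hp)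
    have hc := congrArg (Multiset.count s) h
    rw [count_add_replicate_add hW hx hsub, count_add_replicate_add hW hx hsub'] at hc
    have hc' := Nat.eq_of_mul_eq_mul_left (by positivity) hc
    have hm := congrArg (· % S) hc'
    simp only [Nat.mul_add_mod, Nat.mod_eq_of_lt (hf ν ⟨hν, hb⟩),
      Nat.mod_eq_of_lt (hf ν' ⟨hν', hb'⟩)] at hm
    obtain rfl := hfinj ⟨hν, hb⟩ ⟨hν', hb'⟩ hm
    have hS : 0 < S := (Nat.zero_le _).trans_lt (hf ν ⟨hν, hb⟩)
    have hqq : q lam = q lam' := Nat.eq_of_mul_eq_mul_left hS (by omega)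
    rw [← hqq] at h hqr'
    have h' : lam - Multiset.replicate J (q lam) = lam' - Multiset.replicate J (q lam) := by
      simpa using h
    rw [Prod.mk.injEq]
    refine ⟨rfl, ?_⟩
    rw [← Multiset.sub_add_cancel hqr, h', Multiset.sub_add_cancel hqr']

/-- Double counting: each pair admits at least JxS exchanges of one part p and ν for M(2h + 1)
copies of `s` and a sum r of copies of x, x + 1. Each result arises at most JxS times, since it
determines the exchange once the multiplicity of x in λ less one p, the residue of r mod x, and f(ν)
are known. -/
lemma ncard_infrequent_le (hs : 0 < s) (hW : ∀ p ∈ W, s < p) (hx : x ∈ W) (hx' : x + 1 ∈ W)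
    (hM : 0 < M) (hT : ∀ ν ∈ T, 0 ∉ ν) {B : Set (Multiset ℕ)}
    (hf : ∀ ν ∈ T ∩ B, f ν < S) (hfinj : Set.InjOn f (T ∩ B))
    (hK : ∀ ν ∈ T ∩ B, ν.sum ≤ K) (hJ0 : 0 < J) (hS : 0 < S)
    (hN : K + J * (4 * s * M * (J * x * S) + 4 * (x ^ 2 + 3 * s * M) ^ 2) < N) :
    (splitPairs N W T ∩ {z | z.1 ∈ B ∧ ∀ p, z.2.count p < J}).ncard ≤
      (withLeast N s W ∩ {μ | μ.count s % (2 * M) = M}).ncard := by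
  classical
  have hfinC := (finite_splitPairs (N := N) hW hT).inter_of_left
    {z | z.1 ∈ B ∧ ∀ p, z.2.count p < J}
  have hfinI := (finite_withLeast (N := N) hs hW).inter_of_left
    {μ | μ.count s % (2 * M) = M}
  have hx0 : 0 < x := (Nat.zero_le _).trans_lt (hW x hx)
  rw [Set.ncard_eq_toFinset_card _ hfinC, Set.ncard_eq_toFinset_card _ hfinI]
  set C := hfinC.toFinset with hC
  set I := hfinI.toFinset with hI
  -- Every h < d(p) leaves a remainder of at least x² from p alone. The larger shift x² + 3sM used
  -- below absorbs the rounding in this division.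
  let d : ℕ → ℕ := fun p => (p - (x ^ 2 + s * M)) / (2 * s * M)
  have hd : ∀ p h, h < d p → s * (M * (2 * h + 1)) + x ^ 2 ≤ p := fun p h hh => by
    have h1 : (h + 1) * (2 * s * M) ≤ p - (x ^ 2 + s * M) :=
      (Nat.le_div_iff_mul_le (by positivity)).1 hh
    have h2 : 0 < (h + 1) * (2 * s * M) := by positivity
    have h3 : (h + 1) * (2 * s * M) = s * (M * (2 * h + 1)) + s * M := by ring
    omega
  let E := C.sigma fun z => z.2.toFinset.sigma fun p => Finset.range (d p)
  have hE : C.card * (J * x * S) ≤ E.card := by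
    rw [Finset.card_sigma, ← smul_eq_mul]
    refine Finset.card_nsmul_le_sum _ _ _ fun z hz => ?_
    obtain ⟨⟨hν, hlam, hsum⟩, hb, hcount⟩ := hfinC.mem_toFinset.1 hz
    simp only [Finset.card_sigma, Finset.card_range]
    by_contra! hlt
    have h1 := sum_le_of_count_le (fun p => (hcount p).le) (x ^ 2 + 3 * s * M)
    have h2 : ∑ p ∈ z.2.toFinset, (p - (x ^ 2 + 3 * s * M)) ≤
        2 * s * M * ∑ p ∈ z.2.toFinset, d p := by
      rw [Finset.mul_sum]
      refine Finset.sum_le_sum fun p _ => ?_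
      have e1 := Nat.div_add_mod (p - (x ^ 2 + s * M)) (2 * s * M)
      have e2 := Nat.mod_lt (p - (x ^ 2 + s * M)) (show 0 < 2 * s * M by positivity)
      have e3 : 2 * s * M = 2 * (s * M) := by ring
      have e4 : 3 * s * M = 3 * (s * M) := by ring
      simp only [d]
      omega
    have h3 : 2 * s * M * ∑ p ∈ z.2.toFinset, d p ≤ 2 * s * M * (J * x * S) :=
      Nat.mul_le_mul_left _ hlt.le
    have h4 : z.2.sum ≤ J * (4 * s * M * (J * x * S) + 4 * (x ^ 2 + 3 * s * M) ^ 2) := by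
      refine h1.trans (Nat.mul_le_mul_left _ ?_)
      have : 4 * s * M * (J * x * S) = 2 * (2 * s * M * (J * x * S)) := by ring
      omega
    have := hK z.1 ⟨hν, hb⟩
    omega
  have hEI : E.card ≤ (I ×ˢ (Finset.range J ×ˢ Finset.range x ×ˢ Finset.range S)).card := by
    refine Finset.card_le_card_of_injOn
      (fun e => (e.1.2.erase e.2.1 + Multiset.replicate (M * (2 * e.2.2 + 1)) s +
        pairRep x (e.2.1 + e.1.1.sum - s * (M * (2 * e.2.2 + 1))),
        (e.1.2.erase e.2.1).count x,
        (e.2.1 + e.1.1.sum - s * (M * (2 * e.2.2 + 1))) % x, f e.1.1)) ?_ ?_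
    · rintro ⟨⟨ν, lam⟩, p, h⟩ he
      simp only [E, Finset.mem_coe, Finset.mem_sigma, Multiset.mem_toFinset, Finset.mem_range,
        hC, hfinC.mem_toFinset] at he
      obtain ⟨⟨⟨hν, hlam, hsum⟩, hb, hcount⟩, hp, hh⟩ := he
      simp only at hν hlam hsum hb hcount hp hh
      have hle := hd p h hh
      have hsub : ∀ p' ∈ lam.erase p, p' ∈ W := fun p' hp' => hlam p' (Multiset.mem_of_mem_erase hp')
      simp only [Finset.mem_coe, Finset.mem_product, Finset.mem_range, hI, hfinI.mem_toFinset]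
      refine ⟨⟨add_mem_withLeast hx hx' hsub (by positivity)
        (mod_le_div_of_sq_le hx0 (by omega)) ?_, ?_⟩, ?_, Nat.mod_lt _ hx0, hf ν ⟨hν, hb⟩⟩
      · have := Multiset.sum_erase hp
        omega
      · simp only [Set.mem_ofPred_eq, count_add_replicate_add hW hx hsub]
        rw [show M * (2 * h + 1) = M + 2 * M * h by ring, Nat.add_mul_mod_self_left,
          Nat.mod_eq_of_lt (by omega)]
      · exact (Multiset.count_le_of_le _ (Multiset.erase_le _ _)).trans_lt (hcount x)
    · rintro ⟨⟨ν, lam⟩, p, h⟩ he ⟨⟨ν', lam'⟩, p', h'⟩ he' heq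
      simp only [E, Finset.mem_coe, Finset.mem_sigma, Multiset.mem_toFinset, Finset.mem_range,
        hC, hfinC.mem_toFinset] at he he'
      obtain ⟨⟨⟨hν, hlam, hsum⟩, hb, hcount⟩, hp, hh⟩ := he
      obtain ⟨⟨⟨hν', hlam', hsum'⟩, hb', hcount'⟩, hp', hh'⟩ := he'
      simp only at hν hlam hsum hb hcount hp hh hν' hlam' hsum' hb' hcount' hp' hh'
      have hle := hd p h hh
      have hle' := hd p' h' hh'
      have hsub : ∀ a ∈ lam.erase p, a ∈ W := fun a ha => hlam a (Multiset.mem_of_mem_erase ha)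
      have hsub' : ∀ a ∈ lam'.erase p', a ∈ W := fun a ha =>
        hlam' a (Multiset.mem_of_mem_erase ha)
      simp only [Prod.mk.injEq] at heq
      obtain ⟨hμ, hcx, hmod, hff⟩ := heq
      obtain rfl := hfinj ⟨hν, hb⟩ ⟨hν', hb'⟩ hff
      have hc := congrArg (Multiset.count s) hμ
      rw [count_add_replicate_add hW hx hsub, count_add_replicate_add hW hx hsub'] at hc
      have hc' := Nat.eq_of_mul_eq_mul_left hM hc
      obtain rfl : h = h' := by omega
      -- The multiplicity of x in the image, less the recorded one, is r / x - r % x; with the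
      -- recorded r % x this gives r, hence p.
      have hxs : s ≠ x := (hW x hx).ne
      have hcx' := congrArg (Multiset.count x) hμ
      simp only [Multiset.count_add, hcx, count_pairRep_self, Multiset.count_replicate, if_neg hxs]
        at hcx'
      have hm1 : (p + ν.sum - s * (M * (2 * h + 1))) % x ≤
          (p + ν.sum - s * (M * (2 * h + 1))) / x := mod_le_div_of_sq_le hx0 (by omega)
      have hm2 : (p' + ν.sum - s * (M * (2 * h + 1))) % x ≤
          (p' + ν.sum - s * (M * (2 * h + 1))) / x := mod_le_div_of_sq_le hx0 (by omega)
      have hrr : p + ν.sum - s * (M * (2 * h + 1)) = p' + ν.sum - s * (M * (2 * h + 1)) := by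
        rw [← Nat.div_add_mod (p + ν.sum - s * (M * (2 * h + 1))) x,
          ← Nat.div_add_mod (p' + ν.sum - s * (M * (2 * h + 1))) x, hmod,
          show (p + ν.sum - s * (M * (2 * h + 1))) / x =
            (p' + ν.sum - s * (M * (2 * h + 1))) / x by omega]
      obtain rfl : p = p' := by omega
      have hl : lam.erase p = lam'.erase p := by simpa using hμ
      obtain rfl : lam = lam' := by rw [← Multiset.cons_erase hp, hl, Multiset.cons_erase hp']
      rfl
  have hfin := hE.trans hEI
  simp only [Finset.card_product, Finset.card_range] at hfin
  refine le_of_mul_le_mul_right (a := J * x * S) ?_ (by positivity)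
  calc _ ≤ _ := hfin
    _ = _ := by ring

/-- Comparison of `splitPairs` and `withLeast`. Members of `T` of large sum are encoded by `F`, the
others, which are few, by `f`. -/
theorem ncard_splitPairs_le (hs : 0 < s) (hW : ∀ p ∈ W, s < p) (hx : x ∈ W) (hx' : x + 1 ∈ W)
    (hM : 0 < M) (hT : ∀ ν ∈ T, 0 ∉ ν)
    (hF : ∀ ν ∈ T, s * F ν + x ^ 2 ≤ ν.sum → F ν % M ≠ 0)
    (hFinj : Set.InjOn F (T ∩ {ν | s * F ν + x ^ 2 ≤ ν.sum}))
    (hf : ∀ ν ∈ T ∩ {ν | ν.sum < s * F ν + x ^ 2}, f ν < S)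
    (hfinj : Set.InjOn f (T ∩ {ν | ν.sum < s * F ν + x ^ 2}))
    (hK : ∀ ν ∈ T ∩ {ν | ν.sum < s * F ν + x ^ 2}, ν.sum ≤ K)
    (hJ : ∀ ν ∈ T ∩ {ν | ν.sum < s * F ν + x ^ 2}, ∀ p ∈ W,
      s * (2 * M * (S * p + f ν)) ≤ J * p + ν.sum ∧
      (J * p + ν.sum - s * (2 * M * (S * p + f ν))) % x ≤
        (J * p + ν.sum - s * (2 * M * (S * p + f ν))) / x)
    (hJ0 : 0 < J) (hS : 0 < S)
    (hN : K + J * (4 * s * M * (J * x * S) + 4 * (x ^ 2 + 3 * s * M) ^ 2) < N) :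
    (splitPairs N W T).ncard ≤ (withLeast N s W).ncard := by
  have hfinI := finite_withLeast (N := N) hs hW
  have hcover : splitPairs N W T ⊆ (splitPairs N W T ∩ {z | s * F z.1 + x ^ 2 ≤ z.1.sum}) ∪
      ((splitPairs N W T ∩ {z | z.1 ∈ {ν | ν.sum < s * F ν + x ^ 2} ∧ ∃ p, J ≤ z.2.count p}) ∪
      (splitPairs N W T ∩ {z | z.1 ∈ {ν | ν.sum < s * F ν + x ^ 2} ∧ ∀ p, z.2.count p < J})) := by
    intro z hz
    rcases le_or_gt (s * F z.1 + x ^ 2) z.1.sum with h | h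
    · exact Or.inl ⟨hz, h⟩
    · by_cases h' : ∃ p, J ≤ z.2.count p
      · exact Or.inr (Or.inl ⟨hz, h, h'⟩)
      · exact Or.inr (Or.inr ⟨hz, h, by simpa using h'⟩)
  have hfinC := finite_splitPairs (N := N) hW hT
  have h1 := ncard_big_le (N := N) hs hW hx hx' hF hFinj
  have h2 := ncard_frequent_le (N := N) hs hW hx hx' hM hf hfinj hJ hJ0
  have h3 := ncard_infrequent_le hs hW hx hx' hM hT hf hfinj hK hJ0 hS hN
  have hd1 : Disjoint (withLeast N s W ∩ {μ | μ.count s % (2 * M) = 0})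
      (withLeast N s W ∩ {μ | μ.count s % (2 * M) = M}) := by
    rw [Set.disjoint_left]
    rintro μ ⟨-, ha⟩ ⟨-, hb⟩
    simp only [Set.mem_ofPred_eq] at ha hb
    omega
  have hd2 : Disjoint (withLeast N s W ∩ {μ | μ.count s % M ≠ 0})
      ((withLeast N s W ∩ {μ | μ.count s % (2 * M) = 0}) ∪
      (withLeast N s W ∩ {μ | μ.count s % (2 * M) = M})) := by
    rw [Set.disjoint_left]
    rintro μ ⟨-, ha⟩ hb
    simp only [Set.mem_ofPred_eq] at ha
    have hmm := Nat.mod_mul_left_mod (μ.count s) 2 M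
    rcases hb with ⟨-, hb⟩ | ⟨-, hb⟩ <;>
    · simp only [Set.mem_ofPred_eq] at hb
      rw [hb] at hmm
      simp at hmm
      exact ha hmm.symm
  calc (splitPairs N W T).ncard ≤ _ := Set.ncard_le_ncard hcover
        ((hfinC.inter_of_left _).union ((hfinC.inter_of_left _).union (hfinC.inter_of_left _)))
    _ ≤ _ := Set.ncard_union_le _ _
    _ ≤ _ := Nat.add_le_add h1 ((Set.ncard_union_le _ _).trans (Nat.add_le_add h2 h3))
    _ = _ := by
      rw [← Set.ncard_union_eq hd1 (hfinI.inter_of_left _) (hfinI.inter_of_left _),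
        ← Set.ncard_union_eq hd2 (hfinI.inter_of_left _)
          ((hfinI.inter_of_left _).union (hfinI.inter_of_left _))]
    _ ≤ _ := Set.ncard_le_ncard (Set.union_subset Set.inter_subset_left
        (Set.union_subset Set.inter_subset_left Set.inter_subset_left)) hfinI

end SplitPairs

/-! ### Numbering the multisets on `V` -/

/-- Tuples of natural numbers can be numbered in order of their largest entry. -/
lemma exists_injective_lt_pow (ι : Type*) [Fintype ι] :
    ∃ f : (ι → ℕ) → ℕ, Function.Injective f ∧
      ∀ m k, (∀ i, m i ≤ k) → f m < (k + 1) ^ Fintype.card ι := by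
  classical
  obtain ⟨e, he⟩ := exists_injective_nat (ι → ℕ)
  -- Ties between tuples with equal maximum are broken by an arbitrary injection; the number of a
  -- tuple is how many precede it, all of them in the same box.
  let key : (ι → ℕ) → ℕ ×ₗ ℕ := fun m => toLex (Finset.univ.sup m, e m)
  have hkey : Function.Injective key := fun a b h => he (Prod.ext_iff.1 (toLex.injective h)).2
  have hsub : ∀ m k, (∀ i, m i ≤ k) → {m' | key m' < key m} ⊂
      ((Fintype.piFinset fun _ : ι => Finset.range (k + 1) : Finset (ι → ℕ)) : Set (ι → ℕ)) := by
    intro m k hk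
    refine (Set.ssubset_iff_of_subset fun m' hm' => ?_).2 ⟨m, ?_, ?_⟩
    · have h1 : Finset.univ.sup m' ≤ Finset.univ.sup m := by
        rcases (Prod.Lex.toLex_lt_toLex).1 hm' with h | h
        · exact h.le
        · exact h.1.le
      have h2 : Finset.univ.sup m ≤ k := Finset.sup_le fun i _ => hk i
      simp only [Finset.mem_coe, Fintype.mem_piFinset, Finset.mem_range, Nat.lt_succ_iff]
      exact fun i => (Finset.le_sup (Finset.mem_univ i)).trans (h1.trans h2)
    · simpa [Nat.lt_succ_iff] using hk
    · simp
  have hfin : ∀ m, {m' | key m' < key m}.Finite := fun m =>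
    (Finset.finite_toSet _).subset
      (hsub m _ fun i => Finset.le_sup (f := m) (Finset.mem_univ i)).subset
  have hmono : ∀ a b, key a < key b →
      {m' | key m' < key a}.ncard < {m' | key m' < key b}.ncard := fun a b h =>
    Set.ncard_lt_ncard (t := {m' | key m' < key b})
      ⟨fun m' (hm' : key m' < key a) => lt_trans hm' h,
        fun hc => lt_irrefl (key a) (hc (show a ∈ {m' | key m' < key b} from h))⟩ (hfin b)
  refine ⟨fun m => {m' | key m' < key m}.ncard, fun a b h => ?_, fun m k hk => ?_⟩
  · rcases lt_trichotomy (key a) (key b) with h' | h' | h'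
    · exact absurd h (hmono a b h').ne
    · exact hkey h'
    · exact absurd h (hmono b a h').ne'
  · refine (Set.ncard_lt_ncard (hsub m k hk) (Finset.finite_toSet _)).trans_eq ?_
    rw [Set.ncard_coe_finset, Fintype.card_piFinset]
    simp

/-- Multisets on `V` in which all multiplicities are perfect powers with exponent `|V|`. -/
def powerMultisets (V : Finset ℕ) : Set (Multiset ℕ) :=
  {ν | (∀ p ∈ ν, p ∈ V) ∧ ∀ k ∈ V, ∃ m : ℕ, ν.count k = m ^ V.card}

/-- Number ν by its tuple of roots. Here k is the largest root, attained at some v ≥ s + 1, which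
contributes v·k^t to the sum. -/
lemma exists_code_powerMultisets (V : Finset ℕ) :
    ∃ f : Multiset ℕ → ℕ, Set.InjOn f (powerMultisets V) ∧ ∀ s, (∀ v ∈ V, s < v) → 0 < V.card →
      ∀ ν ∈ powerMultisets V, ∃ k, f ν < (k + 1) ^ V.card ∧ (s + 1) * k ^ V.card ≤ ν.sum := by
  classical
  obtain ⟨g, hg, hgk⟩ := exists_injective_lt_pow V
  have hex : ∀ ν : Multiset ℕ, ∃ m : V → ℕ,
      ν ∈ powerMultisets V → ∀ v : V, ν.count (v : ℕ) = m v ^ V.card := fun ν => by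
    by_cases h : ν ∈ powerMultisets V
    · choose m hm using fun v : V => h.2 v v.2
      exact ⟨m, fun _ => hm⟩
    · exact ⟨0, fun h' => absurd h' h⟩
  choose root hroot using hex
  refine ⟨fun ν => g (root ν), fun ν hν ν' hν' h => ?_, fun s hs hV ν hν => ?_⟩
  · have hr := hg h
    ext p
    by_cases hp : p ∈ V
    · rw [hroot ν hν ⟨p, hp⟩, hroot ν' hν' ⟨p, hp⟩, hr]
    · rw [Multiset.count_eq_zero.2 fun h => hp (hν.1 p h),
        Multiset.count_eq_zero.2 fun h => hp (hν'.1 p h)]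
  · have hne : (Finset.univ : Finset V).Nonempty := by
      obtain ⟨v, hv⟩ := Finset.card_pos.1 hV
      exact ⟨⟨v, hv⟩, Finset.mem_univ _⟩
    obtain ⟨v, -, hv⟩ := Finset.exists_max_image Finset.univ (root ν) hne
    refine ⟨root ν v, ?_, ?_⟩
    · have := hgk (root ν) (root ν v) fun i => hv i (Finset.mem_univ i)
      rwa [Fintype.card_coe] at this
    · rw [← hroot ν hν v]
      have h1 := Multiset.le_count_iff_replicate_le.1 (le_refl (ν.count (v : ℕ)))
      have h2 := congrArg Multiset.sum (Multiset.sub_add_cancel h1)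
      rw [Multiset.sum_add, Multiset.sum_replicate, smul_eq_mul] at h2
      have h3 := Nat.mul_le_mul_right (ν.count (v : ℕ)) (Nat.succ_le_of_lt (hs v v.2))
      rw [Nat.succ_eq_add_one, mul_comm (v : ℕ)] at h3
      omega

/-! ### Numerical estimates -/

/-- Bernoulli's inequality gives (k/(k + 1))^t ≥ 1 - t/(k + 1), and t/(k + 1) ≤ 1/(5s + 1). -/
lemma succ_pow_mul_le {s t k : ℕ} (hk : (5 * s + 1) * t ≤ k + 1) :
    5 * s * (k + 1) ^ t ≤ (5 * s + 1) * k ^ t := by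
  have hb := one_add_mul_le_pow (a := -1 / ((k : ℝ) + 1))
    (by rw [le_div_iff₀ (by positivity)]; linarith [(Nat.cast_nonneg k : (0 : ℝ) ≤ k)]) t
  have hk1 : (0 : ℝ) < (k : ℝ) + 1 := by positivity
  rw [show 1 + -1 / ((k : ℝ) + 1) = k / (k + 1) by field_simp; ring, div_pow,
    le_div_iff₀ (by positivity)] at hb
  have hk' : (5 * (s : ℝ) + 1) * t ≤ k + 1 := by exact_mod_cast hk
  have hp : (0 : ℝ) < ((k : ℝ) + 1) ^ t := by positivity
  have h2 : ((k : ℝ) + 1 - t) * ((k : ℝ) + 1) ^ t ≤ k ^ t * (k + 1) := by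
    have := mul_le_mul_of_nonneg_right hb hk1.le
    calc ((k : ℝ) + 1 - t) * ((k : ℝ) + 1) ^ t
        = (1 + t * (-1 / ((k : ℝ) + 1))) * (k + 1) ^ t * (k + 1) := by field_simp; ring
      _ ≤ _ := this
  have h3 : 5 * (s : ℝ) * ((k : ℝ) + 1) ^ t ≤ (5 * s + 1) * k ^ t := by
    refine le_of_mul_le_mul_right ?_ hk1
    nlinarith [mul_le_mul_of_nonneg_left h2 (by positivity : (0 : ℝ) ≤ 5 * s + 1),
      mul_le_mul_of_nonneg_right hk' hp.le]
  exact_mod_cast h3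

/-- The code costs at most (s + 1/4)(k + 1)^t + s, and (s + 1/4)(1 + 1/(5s)) ≤ s + 1/2; the spare
k^t/2 covers s + x². -/
lemma code_bound {s t k n x : ℕ} (hs : 0 < s) (ht : 0 < t) (hx : x ≤ 4 * s * t)
    (hk : 42 * s ^ 2 * t ^ 2 ≤ k) (hn : n < (k + 1) ^ t) :
    s * (n + n / (4 * s) + 1) + x ^ 2 ≤ (s + 1) * k ^ t := by
  have hst : 1 ≤ s * t := Nat.mul_pos hs ht
  have hst2 : s * t ≤ s ^ 2 * t ^ 2 := by nlinarith
  have ht2 : t ≤ s ^ 2 * t ^ 2 := by nlinarith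
  have hs2 : s ≤ s ^ 2 * t ^ 2 := by nlinarith
  have h1 := succ_pow_mul_le (s := s) (t := t) (k := k) (by nlinarith)
  have h2 : 4 * s * (n / (4 * s)) ≤ n := Nat.mul_div_le _ _
  have h3 : k ≤ k ^ t := Nat.le_self_pow ht.ne' k
  have h4 : x ^ 2 ≤ 16 * (s ^ 2 * t ^ 2) := by
    calc x ^ 2 ≤ (4 * s * t) ^ 2 := Nat.pow_le_pow_left hx 2
      _ = _ := by ring
  have h5 : 2 * s + 2 * x ^ 2 ≤ k ^ t := by nlinarith
  have h6 : 4 * (s * (n + n / (4 * s) + 1)) ≤ (4 * s + 1) * (k + 1) ^ t + 4 * s := by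
    nlinarith
  refine le_of_mul_le_mul_left (a := 20 * s) ?_ (by positivity)
  have h7 := Nat.mul_le_mul_left (5 * s) h6
  have h8 := Nat.mul_le_mul_left (4 * s + 1) h1
  have h9 := Nat.mul_le_mul_left (10 * s) h5
  have h10 : k ^ t ≤ s * k ^ t := Nat.le_mul_of_pos_left _ hs
  nlinarith

lemma threshold_bound {s t x S : ℕ} (hs : 0 < s) (ht : 0 < t) (hx : x ≤ 4 * s * t)
    (hS : S = (42 * s ^ 2 * t ^ 2) ^ t) :
    s * (2 * S + 1) + x ^ 2 + 21 * s ^ 2 * S * (4 * s * (4 * s + 1) * (21 * s ^ 2 * S * x * S) +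
      4 * (x ^ 2 + 3 * s * (4 * s + 1)) ^ 2) <
      (10 * s) ^ 5 * (t + 1) ^ 4 * (39 * s ^ 2 * t ^ 3) ^ (5 * t) := by
  have hS1 : 42 * s ^ 2 * t ^ 2 ≤ S := hS ▸ Nat.le_self_pow ht.ne' _
  have hs1 : 1 ≤ s := hs
  have ht1 : 1 ≤ t := ht
  have hS0 : 1 ≤ S := le_trans (Nat.succ_le_of_lt (by positivity)) hS1
  have hss : s ≤ s ^ 2 := Nat.le_self_pow two_ne_zero s
  have hst : s ^ 2 ≤ s ^ 2 * t ^ 2 := Nat.le_mul_of_pos_right _ (by positivity)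
  have hx2 : x ^ 2 ≤ 16 * (s ^ 2 * t ^ 2) := by
    calc x ^ 2 ≤ (4 * s * t) ^ 2 := Nat.pow_le_pow_left hx 2
      _ = _ := by ring
  have hM : 4 * s + 1 ≤ 5 * s := by omega
  have hA : x ^ 2 + 3 * s * (4 * s + 1) ≤ 31 * (s ^ 2 * t ^ 2) := by nlinarith
  have hu : s ^ 2 * t ^ 2 ≤ S := by nlinarith
  have hA2 : 4 * (x ^ 2 + 3 * s * (4 * s + 1)) ^ 2 ≤ 3844 * (s ^ 5 * t * S ^ 2) := by
    calc 4 * (x ^ 2 + 3 * s * (4 * s + 1)) ^ 2 ≤ 4 * (31 * S) ^ 2 := by gcongr; omega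
      _ = 3844 * (1 * S ^ 2) := by ring
      _ ≤ _ := by gcongr; exact Nat.succ_le_of_lt (by positivity)
  have hB : 4 * s * (4 * s + 1) * (21 * s ^ 2 * S * x * S) ≤ 1680 * (s ^ 5 * t * S ^ 2) := by
    calc 4 * s * (4 * s + 1) * (21 * s ^ 2 * S * x * S)
        ≤ 4 * s * (5 * s) * (21 * s ^ 2 * S * (4 * s * t) * S) := by gcongr
      _ = _ := by ring
  have hKb : s * (2 * S + 1) + x ^ 2 ≤ 19 * (s ^ 7 * t * S ^ 3) := by
    calc s * (2 * S + 1) + x ^ 2 ≤ s * (3 * S) + 16 * S := by gcongr <;> omega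
      _ ≤ s * (3 * S) + s * (16 * S) := by
          exact Nat.add_le_add_left (Nat.le_mul_of_pos_left _ hs) _
      _ = 19 * (s ^ 1 * 1 * S ^ 1) := by ring
      _ ≤ _ := by gcongr <;> omega
  have hL : s * (2 * S + 1) + x ^ 2 + 21 * s ^ 2 * S *
      (4 * s * (4 * s + 1) * (21 * s ^ 2 * S * x * S) +
      4 * (x ^ 2 + 3 * s * (4 * s + 1)) ^ 2) ≤ 116023 * (s ^ 7 * t * S ^ 3) := by
    calc _ ≤ 19 * (s ^ 7 * t * S ^ 3) + 21 * s ^ 2 * S *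
          (1680 * (s ^ 5 * t * S ^ 2) + 3844 * (s ^ 5 * t * S ^ 2)) := by gcongr
      _ = _ := by ring
  -- One factor S absorbs s² in the total of order s⁷tS³, so S⁴ is what must be bounded.
  have hS4 : S ^ 4 ≤ (39 * s ^ 2 * t ^ 3) ^ (5 * t) := by
    rw [hS, ← pow_mul, mul_comm t 4, pow_mul, pow_mul (39 * s ^ 2 * t ^ 3)]
    refine Nat.pow_le_pow_left ?_ t
    calc (42 * s ^ 2 * t ^ 2) ^ 4 = 42 ^ 4 * (s ^ 8 * t ^ 8) := by ring
      _ ≤ 39 ^ 5 * (s ^ 10 * t ^ 15) :=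
          Nat.mul_le_mul (by norm_num) (Nat.mul_le_mul (Nat.pow_le_pow_right hs (by norm_num))
            (Nat.pow_le_pow_right ht (by norm_num)))
      _ = _ := by ring
  have ht8 : 2 * t ≤ (t + 1) ^ 4 := by nlinarith [Nat.one_le_pow 2 (t + 1) (by omega)]
  calc _ ≤ 116023 * (s ^ 7 * t * S ^ 3) := hL
    _ < 200000 * (s ^ 7 * t * S ^ 3) := by
        have : 0 < s ^ 7 * t * S ^ 3 := by positivity
        omega
    _ = 100000 * s ^ 5 * (2 * t) * (s ^ 2 * S ^ 3) := by ring
    _ ≤ 100000 * s ^ 5 * (t + 1) ^ 4 * (S * S ^ 3) := by gcongr; omega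
    _ = (10 * s) ^ 5 * (t + 1) ^ 4 * S ^ 4 := by ring
    _ ≤ _ := by gcongr

/-! ### Application to partitions -/

/-- An interval of length at least `2 |V| + 2` contains two consecutive elements outside `V`. -/
lemma exists_consecutive_notMem (s : ℕ) (V : Finset ℕ) :
    ∃ x, s < x ∧ x ≤ s + 2 * V.card + 1 ∧ x ∉ V ∧ x + 1 ∉ V := by
  by_contra! h
  -- Otherwise `V` meets each of the |V| + 1 disjoint pairs {s + 2i + 1, s + 2i + 2}.
  have hc : ∀ i ∈ Finset.range (V.card + 1), ∃ v ∈ V, (v - s - 1) / 2 = i := fun i hi => by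
    have hi := Finset.mem_range.1 hi
    by_cases hv : s + 2 * i + 1 ∈ V
    · exact ⟨_, hv, by omega⟩
    · exact ⟨_, h (s + 2 * i + 1) (by omega) (by omega) hv, by omega⟩
  have hsub : Finset.range (V.card + 1) ⊆ V.image fun v => (v - s - 1) / 2 := fun i hi =>
    Finset.mem_image.2 (hc i hi)
  have := (Finset.card_le_card hsub).trans Finset.card_image_le
  rw [Finset.card_range] at this
  omega

/-- The elements of `{s + 1, …, L + s}` outside `V`. -/
def allowedParts (L s : ℕ) (V : Finset ℕ) : Set ℕ := {p | p ∈ Finset.Icc (s + 1) (L + s) ∧ p ∉ V}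

lemma zero_notMem_of_mem_powerMultisets {L s : ℕ} {V : Finset ℕ}
    (hV : V ⊆ Finset.Icc (s + 1) (L + s)) : ∀ ν ∈ powerMultisets V, 0 ∉ ν := fun ν hν h0 => by
  have := Finset.mem_Icc.1 (hV (hν.1 0 h0))
  omega

lemma lt_of_mem_allowedParts {L s : ℕ} {V : Finset ℕ} : ∀ p ∈ allowedParts L s V, s < p :=
  fun _ hp => (Finset.mem_Icc.1 hp.1).1

lemma ncard_partitionsD_le {L s : ℕ} {V : Finset ℕ} (hV : V ⊆ Finset.Icc (s + 1) (L + s)) (N : ℕ) :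
    (partitionsD L s V N).ncard ≤
      (splitPairs N (allowedParts L s V) (powerMultisets V)).ncard := by
  refine Set.ncard_le_ncard_of_injOn
    (fun π => (π.parts.filter (· ∈ V), π.parts.filter (· ∉ V))) ?_ ?_
    (finite_splitPairs lt_of_mem_allowedParts (zero_notMem_of_mem_powerMultisets hV))
  · rintro π ⟨-, h1, h2⟩
    refine ⟨⟨fun p hp => (Multiset.mem_filter.1 hp).2, fun k hk => ?_⟩, fun p hp => ?_, ?_⟩
    · simpa only [Multiset.count_filter_of_pos hk] using h2 k hk
    · exact ⟨h1 p (Multiset.mem_filter.1 hp).1, (Multiset.mem_filter.1 hp).2⟩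
    · rw [← Multiset.sum_add, Multiset.filter_add_not, π.parts_sum]
  · intro π _ π' _ h
    have h := Prod.ext_iff.1 h
    ext1
    rw [← Multiset.filter_add_not (· ∈ V) π.parts, ← Multiset.filter_add_not (· ∈ V) π'.parts]
    exact congrArg₂ _ h.1 h.2

lemma ncard_withLeast_le {L s : ℕ} (hs : 0 < s) {V : Finset ℕ}
    (hV : V ⊆ Finset.Icc (s + 1) (L + s)) (N : ℕ) :
    (withLeast N s (allowedParts L s V)).ncard ≤ (partitionsI L s V N).ncard := by
  have hsub : withLeast N s (allowedParts L s V) ⊆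
      (fun π : Nat.Partition N => π.parts) '' partitionsI L s V N := by
    rintro μ ⟨hsμ, hμ, hsum⟩
    have hle : ∀ p ∈ μ, s ≤ p := fun p hp => by
      rcases hμ p hp with rfl | h
      · exact le_rfl
      · exact (lt_of_mem_allowedParts p h).le
    refine ⟨⟨μ, fun {i} hi => hs.trans_le (hle i hi), hsum⟩, ⟨⟨hsμ, fun p hp => hle p hp⟩, ?_, ?_⟩,
      rfl⟩
    · intro p hp
      rcases hμ p hp with rfl | h
      · omega
      · exact (Finset.mem_Icc.1 h.1).2
    · intro k hk hkμ
      rcases hμ k hkμ with rfl | h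
      · have := Finset.mem_Icc.1 (hV hk)
        omega
      · exact h.2 hk
  exact (Set.ncard_le_ncard hsub ((Set.toFinite _).image _)).trans
    (Set.ncard_image_le (Set.toFinite _))

lemma ncard_splitPairs_le_of_empty {L s N : ℕ} (hs : 0 < s) (hL : 2 ≤ L)
    (hN : (10 * s) ^ 5 ≤ N) :
    (splitPairs N (allowedParts L s ∅) (powerMultisets ∅)).ncard ≤
      (withLeast N s (allowedParts L s ∅)).ncard := by
  have h0 : ∀ ν ∈ powerMultisets ∅, ν = 0 := fun ν hν =>
    Multiset.eq_zero_of_forall_notMem fun p hp => by simpa using hν.1 p hp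
  have hinj : ∀ A : Set (Multiset ℕ), Set.InjOn (fun _ => 0 : Multiset ℕ → ℕ)
      (powerMultisets ∅ ∩ A) := fun A a ha b hb _ => by rw [h0 a ha.1, h0 b hb.1]
  -- Only ν = 0 occurs, and it is never big, so M = 1 is harmless. With J = 2s, the J copies of p
  -- become exactly 2p copies of s, with remainder 0.
  refine ncard_splitPairs_le (x := s + 1) (M := 1) (S := 1) (J := 2 * s) (K := 0)
    (f := fun _ => 0) (F := fun _ => 0) hs lt_of_mem_allowedParts ?_ ?_ one_pos ?_ ?_ (hinj _)
    ?_ (hinj _) ?_ ?_ (by omega) one_pos ?_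
  · exact ⟨Finset.mem_Icc.2 ⟨by omega, by omega⟩, by simp⟩
  · exact ⟨Finset.mem_Icc.2 ⟨by omega, by omega⟩, by simp⟩
  · intro ν hν
    simp [h0 ν hν]
  · intro ν hν h
    simp [h0 ν hν] at h
  · simp
  · rintro ν ⟨hν, -⟩
    simp [h0 ν hν]
  · rintro ν ⟨hν, -⟩ p -
    have : 2 * s * p = s * (2 * p) := by ring
    simp [h0 ν hν, this]
  · refine lt_of_lt_of_le ?_ hN
    have hs1 : 1 ≤ s := hs
    have h1 : 4 * s * 1 * (2 * s * (s + 1) * 1) ≤ 4 * s * (2 * s * (2 * s)) * s := by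
      calc 4 * s * 1 * (2 * s * (s + 1) * 1) = 4 * s * (2 * s * (s + 1)) * 1 := by ring
        _ ≤ 4 * s * (2 * s * (2 * s)) * s := by gcongr; omega
    have h2 : (s + 1) ^ 2 + 3 * s * 1 ≤ 7 * s ^ 2 := by nlinarith
    calc 0 + 2 * s * (4 * s * 1 * (2 * s * (s + 1) * 1) + 4 * ((s + 1) ^ 2 + 3 * s * 1) ^ 2)
        ≤ 2 * s * (4 * s * (2 * s * (2 * s)) * s + 4 * (7 * s ^ 2) ^ 2) := by
          rw [zero_add]
          gcongr
      _ = 424 * s ^ 5 := by ring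
      _ < 100000 * s ^ 5 := by
          have : 0 < s ^ 5 := by positivity
          omega
      _ = (10 * s) ^ 5 := by ring

lemma ncard_splitPairs_le_of_card_pos {L s N : ℕ} (hs : 0 < s) {V : Finset ℕ}
    (hV : V ⊆ Finset.Icc (s + 1) (L + s)) (ht : 0 < V.card) (hL : 2 * V.card + 2 ≤ L)
    (hN : (10 * s) ^ 5 * (V.card + 1) ^ 4 * (39 * s ^ 2 * V.card ^ 3) ^ (5 * V.card) ≤ N) :
    (splitPairs N (allowedParts L s V) (powerMultisets V)).ncard ≤
      (withLeast N s (allowedParts L s V)).ncard := by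
  obtain ⟨x, hsx, hxt, hxV, hxV'⟩ := exists_consecutive_notMem s V
  obtain ⟨f, hf, hfk⟩ := exists_code_powerMultisets V
  replace hfk := hfk s (fun v hv => (Finset.mem_Icc.1 (hV hv)).1) ht
  set t := V.card with htdef
  have hx4 : x ≤ 4 * s * t := by nlinarith
  obtain ⟨S, hS⟩ : ∃ S, S = (42 * s ^ 2 * t ^ 2) ^ t := ⟨_, rfl⟩
  have hS1 : 42 * s ^ 2 * t ^ 2 ≤ S := hS ▸ Nat.le_self_pow ht.ne' _
  have hx2 : x ^ 2 ≤ 16 * (s ^ 2 * t ^ 2) := by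
    calc x ^ 2 ≤ (4 * s * t) ^ 2 := Nat.pow_le_pow_left hx4 2
      _ = _ := by ring
  have hS0 : 0 < S := hS ▸ by positivity
  have hsmall : ∀ ν ∈ powerMultisets V ∩
      {ν | ν.sum < s * (f ν + f ν / (4 * s) + 1) + x ^ 2}, f ν < S := by
    rintro ν ⟨hν, hb⟩
    obtain ⟨k, hk1, hk2⟩ := hfk ν hν
    by_cases hk : 42 * s ^ 2 * t ^ 2 ≤ k
    · exact absurd hb (not_lt.2 ((code_bound hs ht hx4 hk hk1).trans hk2))
    · exact hk1.trans_le (hS ▸ Nat.pow_le_pow_left (by omega) t)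
  -- F composes f with the increasing enumeration of the positive integers not divisible by 4s + 1.
  -- The frequent trade costs at most 20s²Sp, so J = 21s²S leaves s²Sp ≥ x².
  refine ncard_splitPairs_le (x := x) (M := 4 * s + 1) (S := S) (J := 21 * s ^ 2 * S)
    (K := s * (2 * S + 1) + x ^ 2) (f := f) (F := fun ν => f ν + f ν / (4 * s) + 1)
    hs lt_of_mem_allowedParts ?_ ?_ (by omega) (zero_notMem_of_mem_powerMultisets hV) ?_ ?_ hsmall
    (hf.mono Set.inter_subset_left) ?_ ?_ (by positivity) hS0
    ((threshold_bound hs ht hx4 hS).trans_le hN)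
  · exact ⟨Finset.mem_Icc.2 ⟨by omega, by omega⟩, hxV⟩
  · exact ⟨Finset.mem_Icc.2 ⟨by omega, by omega⟩, hxV'⟩
  · intro ν _ _
    have h1 := Nat.div_add_mod (f ν) (4 * s)
    have h2 := Nat.mod_lt (f ν) (show 0 < 4 * s by omega)
    rw [show f ν + f ν / (4 * s) + 1 = f ν % (4 * s) + 1 + (4 * s + 1) * (f ν / (4 * s)) by
      linarith, Nat.add_mul_mod_self_left, Nat.mod_eq_of_lt (by omega)]
    omega
  · rintro ν ⟨hν, -⟩ ν' ⟨hν', -⟩ h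
    refine hf hν hν' ?_
    simp only at h
    rcases lt_trichotomy (f ν) (f ν') with h' | h' | h'
    · have := Nat.div_le_div_right (c := 4 * s) h'.le
      omega
    · exact h'
    · have := Nat.div_le_div_right (c := 4 * s) h'.le
      omega
  · rintro ν hν
    have h1 := hsmall ν hν
    have h2 : f ν / (4 * s) ≤ f ν := Nat.div_le_self _ _
    refine le_of_lt (lt_of_lt_of_le hν.2 ?_)
    gcongr
    omega
  · rintro ν hν p hp
    have h1 := hsmall ν hν
    have hp0 : 1 ≤ p := (Nat.zero_le _).trans_lt (lt_of_mem_allowedParts p hp)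
    have h2 : s * (2 * (4 * s + 1) * (S * p + f ν)) ≤ 20 * s ^ 2 * S * p := by
      calc s * (2 * (4 * s + 1) * (S * p + f ν)) ≤ s * (2 * (5 * s) * (S * p + S * p)) := by
            gcongr
            · omega
            · exact h1.le.trans (Nat.le_mul_of_pos_right _ hp0)
        _ = _ := by ring
    have h3 : x ^ 2 ≤ s ^ 2 * S * p := by
      calc x ^ 2 ≤ 1 * S * 1 := by nlinarith
        _ ≤ _ := by gcongr; exact Nat.succ_le_of_lt (by positivity)
    have h4 : 21 * s ^ 2 * S * p = 20 * s ^ 2 * S * p + s ^ 2 * S * p := by ring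
    exact ⟨by omega, mod_le_div_of_sq_le (by omega) (by omega)⟩

theorem theorem6 (L s t : ℕ) (hs : 1 ≤ s) (V : Finset ℕ)
    (hV : V ⊆ Finset.Icc (s + 1) (L + s)) (ht : t = V.card)
    (htL : (t : ℝ) ≤ ((L : ℝ) - 2) / 2)
    (N : ℕ) (hN : (10 * s) ^ 5 * (t + 1) ^ 4 * (39 * s ^ 2 * t ^ 3) ^ (5 * t) ≤ N) :
    (partitionsI L s V N).ncard ≥ (partitionsD L s V N).ncard := by

  subst ht
  have hL : 2 * V.card + 2 ≤ L := by
    have : 2 * (V.card : ℝ) + 2 ≤ L := by linarith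
    exact_mod_cast this
  refine (ncard_partitionsD_le hV N).trans (le_trans ?_ (ncard_withLeast_le hs hV N))
  rcases Nat.eq_zero_or_pos V.card with h0 | h0
  · obtain rfl := Finset.card_eq_zero.1 h0
    exact ncard_splitPairs_le_of_empty hs (by simpa using hL) (by simpa using hN)
  · exact ncard_splitPairs_le_of_card_pos hs hV h0 hL hN
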